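/- A map $g:\mathbb{R}^d\to\mathbb{R}^d$ is a similitude with similarity ratio $\rho>0$ if $|g(x)-g(y)|=\rho\,|x-y|$ for all $x,y\in\mathbb{R}^d$ (Euclidean norm). Let $r\ge 2$, let $\varphi_1,\dots,\varphi_r$ be similitudes of $\mathbb{R}^d$, and let $K\subset\mathbb{R}^d$ be a nonempty compact set with $$K=\varphi_1(K)\cup\dots\cup\varphi_r(K),$$ the union being disjoint; that is, $K$ is a self-similar set satisfying the strong separation condition (under these assumptions the $\varphi_i$ are automatically contractions). For a finite, possibly empty, sequence (multi-index) $I=(i_1,\dots,i_n)$ of elements of $\{1,\dots,r\}$ put $\varphi_I=\varphi_{i_1}\circ\dots\circ\varphi_{i_n}$, with $\varphi_\emptyset=\mathrm{id}$. Let $\lambda$ be a similitude of $\mathbb{R}^d$ with $\lambda(K)\subset K$. Then: (1) There exist an integer $k\ge 1$ and multi-indices $I,J$ such that $$\lambda^k\circ\varphi_I=\varphi_J \quad\text{on the affine span of } K,$$ where $\lambda^k$ is the $k$-fold composition of $\lambda$. In particular, $\lambda^k\circ\varphi_I=\varphi_J$ on $\mathbb{R}^d$ if $K$ is not contained in a proper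 affine subspace of $\mathbb{R}^d$. (2) If $a_1,\dots,a_r$ and $b$ are the similarity ratios of $\varphi_1,\dots,\varphi_r$ and $\lambda$, respectively, then $\log b$ is a linear combination of $\log a_1,\dots,\log a_r$ with rational coefficients. -/

import Mathlib

/-- `g : ℝᵈ → ℝᵈ` is a similitude with similarity ratio `ρ > 0` (Euclidean distance). -/
def IsSimilitudeWithRatio {d : ℕ} (g : EuclideanSpace ℝ (Fin d) → EuclideanSpace ℝ (Fin d))
    (ρ : ℝ) : Prop :=
  0 < ρ ∧ ∀ x y, dist (g x) (g y) = ρ * dist x y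

/-- `g : ℝᵈ → ℝᵈ` is a similitude: it multiplies all distances by some constant `ρ > 0`. -/
def IsSimilitude {d : ℕ} (g : EuclideanSpace ℝ (Fin d) → EuclideanSpace ℝ (Fin d)) : Prop :=
  ∃ ρ : ℝ, IsSimilitudeWithRatio g ρ

/-- `K` is a (nonempty, compact) self-similar set represented by the `r ≥ 2` similitudes
`φ 0, …, φ (r - 1)`, that is, `K` is the union of the sets `φ i (K)`. -/
structure IsSelfSimilar {d r : ℕ} (K : Set (EuclideanSpace ℝ (Fin d)))
    (φ : Fin r → EuclideanSpace ℝ (Fin d) → EuclideanSpace ℝ (Fin d)) : Prop where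
  two_le : 2 ≤ r
  isCompact : IsCompact K
  nonempty : K.Nonempty
  isSimilitude : ∀ i, IsSimilitude (φ i)
  eq_iUnion : K = ⋃ i, φ i '' K

/-- The strong separation condition: the sets `φ i (K)` are pairwise disjoint. -/
def StrongSeparation {d r : ℕ} (K : Set (EuclideanSpace ℝ (Fin d)))
    (φ : Fin r → EuclideanSpace ℝ (Fin d) → EuclideanSpace ℝ (Fin d)) : Prop :=
  ∀ i j, i ≠ j → Disjoint (φ i '' K) (φ j '' K)

/-- For a multi-index `I = [i₁, …, iₙ]`, the map `φ_I = φ i₁ ∘ ⋯ ∘ φ iₙ`; the empty multi-index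
gives the identity. -/
def multiComp {d r : ℕ} (φ : Fin r → EuclideanSpace ℝ (Fin d) → EuclideanSpace ℝ (Fin d)) :
    List (Fin r) → EuclideanSpace ℝ (Fin d) → EuclideanSpace ℝ (Fin d)
  | [] => id
  | i :: I => φ i ∘ multiComp φ I

/-! Factor each iterate as λⁿ = φ_{Iₙ} ∘ fₙ, where φ_{Iₙ}(K) is a cylinder containing λⁿ(K) and not
much larger. Then fₙ is a similitude of K into itself with ratio at least some c > 0 independent of
n (`exists_factorization`). Up to equality on K there are only finitely many such maps
(`exists_lt_eqOn`), so fₙ = fₘ on K for some n < m. Hence λ^(m-n) ∘ φ_{Iₙ} and φ_{Iₘ} agree on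
fₙ(K), and so on its affine span, which is that of K. Comparing ratios and taking logarithms gives
(2).

Finiteness is compactness plus rigidity. Such maps subconverge uniformly on K to a similitude g, and
fₙ(K) eventually fills almost all of g(K) for the Hausdorff measure H^s, where Σ aᵢ^s = 1 and 0 <
H^s(K) < ∞. So g⁻¹ ∘ fₙ is close to the identity on K and its image of K misses little of K. By
`exists_rigidity` such a map fixes K pointwise: if its largest displacement δ were positive, zooming
in on a cylinder of size comparable to δ would turn it into almost a translation by a vector of
length bounded below. That misses a definite fraction of K, whereas averaging provides a cylinder of
this size where only a smaller fraction is missed. -/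

open MeasureTheory Measure Metric Set Filter Topology
open scoped ENNReal NNReal

/-! ### Similitudes as affine bijections, and the scaling of Hausdorff measure -/

namespace IsSimilitudeWithRatio

variable {d : ℕ} {f g : EuclideanSpace ℝ (Fin d) → EuclideanSpace ℝ (Fin d)} {ρ σ : ℝ}

theorem comp (hf : IsSimilitudeWithRatio f ρ) (hg : IsSimilitudeWithRatio g σ) :
    IsSimilitudeWithRatio (f ∘ g) (ρ * σ) :=
  ⟨mul_pos hf.1 hg.1, fun x y => by simp [hf.2, hg.2, mul_assoc]⟩

theorem id : IsSimilitudeWithRatio (d := d) id 1 := ⟨one_pos, by simp⟩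

theorem iterate (hf : IsSimilitudeWithRatio f ρ) (n : ℕ) :
    IsSimilitudeWithRatio f^[n] (ρ ^ n) := by
  induction n with
  | zero => simpa using IsSimilitudeWithRatio.id
  | succ n ih =>
    rw [Function.iterate_succ', pow_succ']
    exact hf.comp ih

theorem lipschitzWith (hf : IsSimilitudeWithRatio f ρ) : LipschitzWith ρ.toNNReal f :=
  LipschitzWith.of_dist_le_mul fun x y => by rw [hf.2, Real.coe_toNNReal _ hf.1.le]

theorem continuous (hf : IsSimilitudeWithRatio f ρ) : Continuous f := hf.lipschitzWith.continuous

theorem injective (hf : IsSimilitudeWithRatio f ρ) : Function.Injective f := fun x y h => by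
  have := hf.2 x y
  rw [h, dist_self, zero_eq_mul] at this
  exact dist_eq_zero.1 (this.resolve_left hf.1.ne')

/-- Divided by its ratio, a similitude is an isometry, and isometries into a strictly convex space
are affine. -/
theorem exists_affine (hf : IsSimilitudeWithRatio f ρ) :
    ∃ (L : EuclideanSpace ℝ (Fin d) →L[ℝ] EuclideanSpace ℝ (Fin d)) (v : EuclideanSpace ℝ (Fin d)),
      ∀ x, f x = L x + v := by
  have hi : Isometry fun x => ρ⁻¹ • f x := Isometry.of_dist_eq fun x y => by
    rw [dist_smul₀, hf.2, Real.norm_eq_abs, abs_of_pos (inv_pos.2 hf.1),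
      inv_mul_cancel_left₀ hf.1.ne']
  let e := hi.affineIsometryOfStrictConvexSpace
  refine ⟨ρ • e.linearIsometry.toContinuousLinearMap, f 0, fun x => ?_⟩
  have h1 : e x = e.linearIsometry x + e 0 := by
    simpa using e.map_vadd 0 x
  have h2 : ∀ y, f y = ρ • e y := fun y => by
    simp [e, smul_smul, mul_inv_cancel₀ hf.1.ne']
  rw [h2, h1, smul_add, ← h2]
  rfl

theorem exists_inverse (hf : IsSimilitudeWithRatio f ρ) :
    ∃ g, IsSimilitudeWithRatio g ρ⁻¹ ∧ Function.LeftInverse g f ∧ Function.RightInverse g f := by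
  obtain ⟨L, v, hL⟩ := hf.exists_affine
  have hinj : Function.Injective L := fun x y h => hf.injective (by rw [hL, hL, h])
  have hsurj : Function.Surjective f := fun y => by
    obtain ⟨x, hx⟩ := (LinearMap.injective_iff_surjective (f := (L : _ →ₗ[ℝ] _))).1 hinj (y - v)
    exact ⟨x, by rw [hL]; change L x = _ at hx; rw [hx]; simp⟩
  obtain ⟨g, hg⟩ := hsurj.hasRightInverse
  refine ⟨g, ⟨inv_pos.2 hf.1, fun x y => ?_⟩, fun x => hf.injective (hg (f x)), hg⟩
  conv_rhs => rw [← hg x, ← hg y, hf.2]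
  rw [inv_mul_cancel_left₀ hf.1.ne']

theorem hausdorffMeasure_image_le (hf : IsSimilitudeWithRatio f ρ) {s : ℝ} (hs : 0 ≤ s)
    (A : Set (EuclideanSpace ℝ (Fin d))) :
    μH[s] (f '' A) ≤ ENNReal.ofReal (ρ ^ s) * μH[s] A := by
  have := hf.lipschitzWith.hausdorffMeasure_image_le hs A
  rwa [← ENNReal.ofReal_rpow_of_pos hf.1]

theorem hausdorffMeasure_image (hf : IsSimilitudeWithRatio f ρ) {s : ℝ} (hs : 0 ≤ s)
    (A : Set (EuclideanSpace ℝ (Fin d))) :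
    μH[s] (f '' A) = ENNReal.ofReal (ρ ^ s) * μH[s] A := by
  refine (hf.hausdorffMeasure_image_le hs A).antisymm ?_
  obtain ⟨g, hg, hl, -⟩ := hf.exists_inverse
  calc _ = ENNReal.ofReal (ρ ^ s) * μH[s] (g '' (f '' A)) := by rw [hl.image_image]
    _ ≤ ENNReal.ofReal (ρ ^ s) * (ENNReal.ofReal (ρ⁻¹ ^ s) * μH[s] (f '' A)) := by
        gcongr; exact hg.hausdorffMeasure_image_le hs _
    _ = _ := by
        have := hf.1
        rw [← mul_assoc, ← ENNReal.ofReal_mul (by positivity), Real.inv_rpow this.le,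
          mul_inv_cancel₀ (by positivity)]
        simp

end IsSimilitudeWithRatio

/-! ### Words, cylinders and separation -/

/-- A self-similar set with strong separation, together with the ratios of its similitudes. -/
structure IsSeparatedIFS {d r : ℕ} (K : Set (EuclideanSpace ℝ (Fin d)))
    (φ : Fin r → EuclideanSpace ℝ (Fin d) → EuclideanSpace ℝ (Fin d)) (a : Fin r → ℝ) : Prop where
  selfSimilar : IsSelfSimilar K φ
  separated : StrongSeparation K φ
  ratio : ∀ i, IsSimilitudeWithRatio (φ i) (a i)

/-- The similarity ratio of `multiComp φ I`. -/
def wordRatio {r : ℕ} (a : Fin r → ℝ) (I : List (Fin r)) : ℝ := (I.map a).prod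

section wordRatio

variable {r : ℕ} {a : Fin r → ℝ}

@[simp] theorem wordRatio_nil : wordRatio a [] = 1 := rfl

@[simp] theorem wordRatio_cons (i : Fin r) (I : List (Fin r)) :
    wordRatio a (i :: I) = a i * wordRatio a I := by simp [wordRatio]

theorem wordRatio_append (I J : List (Fin r)) :
    wordRatio a (I ++ J) = wordRatio a I * wordRatio a J := by simp [wordRatio]

theorem wordRatio_pos (ha : ∀ i, 0 < a i) (I : List (Fin r)) : 0 < wordRatio a I := by
  induction I with
  | nil => simp
  | cons i I ih => simpa using mul_pos (ha i) ih

theorem pow_length_le_wordRatio {m : ℝ} (hm : 0 < m) (ha : ∀ i, m ≤ a i) (I : List (Fin r)) :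
    m ^ I.length ≤ wordRatio a I := by
  induction I with
  | nil => simp
  | cons i I ih =>
    rw [List.length_cons, pow_succ', wordRatio_cons]
    exact mul_le_mul (ha i) ih (by positivity) (hm.le.trans (ha i))

theorem wordRatio_le_pow_length {q : ℝ} (ha : ∀ i, 0 < a i) (hq : ∀ i, a i ≤ q)
    (I : List (Fin r)) : wordRatio a I ≤ q ^ I.length := by
  induction I with
  | nil => simp
  | cons i I ih =>
    rw [List.length_cons, pow_succ', wordRatio_cons]
    exact mul_le_mul (hq i) ih (wordRatio_pos ha I).le ((ha i).le.trans (hq i))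

theorem log_wordRatio (ha : ∀ i, 0 < a i) (I : List (Fin r)) :
    Real.log (wordRatio a I) = ∑ i, (I.count i : ℝ) * Real.log (a i) := by
  induction I with
  | nil => simp
  | cons j I ih =>
    rw [wordRatio_cons, Real.log_mul (ha j).ne' (wordRatio_pos ha I).ne', ih]
    simp only [List.count_cons, Nat.cast_add, add_mul, Finset.sum_add_distrib, beq_iff_eq]
    rw [add_comm]
    simp

end wordRatio

theorem multiComp_append {d r : ℕ}
    (φ : Fin r → EuclideanSpace ℝ (Fin d) → EuclideanSpace ℝ (Fin d)) (I J : List (Fin r)) :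
    multiComp φ (I ++ J) = multiComp φ I ∘ multiComp φ J := by
  induction I with
  | nil => rfl
  | cons i I ih => simp only [List.cons_append, multiComp, ih]; rfl

namespace IsSeparatedIFS

variable {d r : ℕ} {K : Set (EuclideanSpace ℝ (Fin d))}
  {φ : Fin r → EuclideanSpace ℝ (Fin d) → EuclideanSpace ℝ (Fin d)} {a : Fin r → ℝ}

theorem pos (h : IsSeparatedIFS K φ a) (i : Fin r) : 0 < a i := (h.ratio i).1

theorem map_mem (h : IsSeparatedIFS K φ a) (i : Fin r) {x} (hx : x ∈ K) : φ i x ∈ K := by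
  rw [h.selfSimilar.eq_iUnion]
  exact mem_iUnion.2 ⟨i, mem_image_of_mem _ hx⟩

theorem exists_preimage (h : IsSeparatedIFS K φ a) {x} (hx : x ∈ K) : ∃ i, ∃ y ∈ K, φ i y = x := by
  rw [h.selfSimilar.eq_iUnion] at hx
  simpa using hx

theorem map_ne (h : IsSeparatedIFS K φ a) {i j : Fin r} (hij : i ≠ j) {x y} (hx : x ∈ K)
    (hy : y ∈ K) : φ i x ≠ φ j y := fun e =>
  (h.separated i j hij).le_bot ⟨mem_image_of_mem _ hx, e ▸ mem_image_of_mem _ hy⟩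

theorem exists_ne (h : IsSeparatedIFS K φ a) : ∃ x ∈ K, ∃ y ∈ K, x ≠ y := by
  obtain ⟨x, hx⟩ := h.selfSimilar.nonempty
  have := h.selfSimilar.two_le
  exact ⟨_, h.map_mem ⟨0, by omega⟩ hx, _, h.map_mem ⟨1, by omega⟩ hx,
    h.map_ne (by simp) hx hx⟩

theorem similitude (h : IsSeparatedIFS K φ a) (I : List (Fin r)) :
    IsSimilitudeWithRatio (multiComp φ I) (wordRatio a I) := by
  induction I with
  | nil => exact IsSimilitudeWithRatio.id
  | cons i I ih => rw [wordRatio_cons]; exact (h.ratio i).comp ih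

theorem multiComp_mem (h : IsSeparatedIFS K φ a) (I : List (Fin r)) {x} (hx : x ∈ K) :
    multiComp φ I x ∈ K := by
  induction I with
  | nil => exact hx
  | cons i I ih => exact h.map_mem i ih

theorem image_subset (h : IsSeparatedIFS K φ a) (I : List (Fin r)) : multiComp φ I '' K ⊆ K := by
  rintro _ ⟨x, hx, rfl⟩
  exact h.multiComp_mem I hx

theorem image_eq_iUnion (h : IsSeparatedIFS K φ a) (I : List (Fin r)) :
    multiComp φ I '' K = ⋃ i, multiComp φ (I ++ [i]) '' K := by
  conv_lhs => rw [h.selfSimilar.eq_iUnion, image_iUnion]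
  simp only [multiComp_append, image_comp]
  rfl

theorem isCompact_image (h : IsSeparatedIFS K φ a) (I : List (Fin r)) :
    IsCompact (multiComp φ I '' K) :=
  h.selfSimilar.isCompact.image (h.similitude I).continuous

theorem exists_separation (h : IsSeparatedIFS K φ a) :
    ∃ η > 0, ∀ i j, i ≠ j → ∀ x ∈ K, ∀ y ∈ K, η ≤ dist (φ i x) (φ j y) := by
  have h1 : ∀ p : Fin r × Fin r, ∃ η > 0, p.1 ≠ p.2 →
      ∀ x ∈ K, ∀ y ∈ K, η ≤ dist (φ p.1 x) (φ p.2 y) := fun p => by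
    by_cases hp : p.1 = p.2
    · exact ⟨1, one_pos, fun hne => (hne hp).elim⟩
    have hc : Continuous fun z : EuclideanSpace ℝ (Fin d) × EuclideanSpace ℝ (Fin d) =>
        dist (φ p.1 z.1) (φ p.2 z.2) :=
      ((h.ratio p.1).continuous.comp continuous_fst).dist
        ((h.ratio p.2).continuous.comp continuous_snd)
    obtain ⟨z, hz, hmin⟩ := (h.selfSimilar.isCompact.prod h.selfSimilar.isCompact).exists_isMinOn
      (h.selfSimilar.nonempty.prod h.selfSimilar.nonempty) hc.continuousOn
    exact ⟨_, dist_pos.2 (h.map_ne hp hz.1 hz.2),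
      fun _ x hx y hy => isMinOn_iff.1 hmin (x, y) ⟨hx, hy⟩⟩
  choose η hη hdist using h1
  obtain ⟨x, hx⟩ := h.selfSimilar.nonempty
  have : Nonempty (Fin r) := ⟨(h.exists_preimage hx).choose⟩
  obtain ⟨p, hp⟩ := Finite.exists_min η
  exact ⟨η p, hη p, fun i j hij x hx y hy => (hp (i, j)).trans (hdist (i, j) hij x hx y hy)⟩

/-- If `a i ≥ 1`, the orbit under `φ i` of a point of another piece is an infinite η-separated
sequence in the compact set K. -/
theorem ratio_lt_one (h : IsSeparatedIFS K φ a) (i : Fin r) : a i < 1 := by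
  by_contra! hai
  obtain ⟨η, hη, hsep⟩ := h.exists_separation
  obtain ⟨p, hp⟩ := h.selfSimilar.nonempty
  have := h.selfSimilar.two_le
  obtain ⟨j, hj⟩ : ∃ j : Fin r, j ≠ i := by
    have : Nontrivial (Fin r) := Fin.nontrivial_iff_two_le.2 this
    exact _root_.exists_ne i
  have hmem : ∀ n, (φ i)^[n] (φ j p) ∈ K := fun n => by
    induction n with
    | zero => exact h.map_mem j hp
    | succ n ih => rw [Function.iterate_succ_apply']; exact h.map_mem i ih
  have hdist : ∀ n k, η ≤ dist ((φ i)^[n] (φ j p)) ((φ i)^[n + (k + 1)] (φ j p)) := fun n k => by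
    rw [Function.iterate_add_apply, ((h.ratio i).iterate n).2, Function.iterate_succ_apply']
    exact (hsep j i hj p hp _ (hmem k)).trans
      (le_mul_of_one_le_left dist_nonneg (one_le_pow₀ hai))
  obtain ⟨x, -, σ, hσ, hx⟩ := h.selfSimilar.isCompact.tendsto_subseq hmem
  obtain ⟨N, hN⟩ := Metric.cauchySeq_iff'.1 hx.cauchySeq η hη
  have h1 := hN (N + 1) (by omega)
  have h2 := hσ (Nat.lt_succ_self N)
  obtain ⟨k, hk⟩ : ∃ k, σ (N + 1) = σ N + (k + 1) := ⟨σ (N + 1) - σ N - 1, by grind⟩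
  have h3 := hdist (σ N) k
  rw [← hk, dist_comm] at h3
  exact absurd h1 (not_lt.2 h3)

theorem exists_bounds (h : IsSeparatedIFS K φ a) :
    ∃ m q : ℝ, 0 < m ∧ m < 1 ∧ 0 < q ∧ q < 1 ∧ (∀ i, m ≤ a i) ∧ ∀ i, a i ≤ q := by
  obtain ⟨x, hx⟩ := h.selfSimilar.nonempty
  have : Nonempty (Fin r) := ⟨(h.exists_preimage hx).choose⟩
  obtain ⟨i, hi⟩ := Finite.exists_min a
  obtain ⟨j, hj⟩ := Finite.exists_max a
  exact ⟨a i, a j, h.pos i, h.ratio_lt_one i, h.pos j, h.ratio_lt_one j, hi, hj⟩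

theorem wordRatio_le_one (h : IsSeparatedIFS K φ a) (I : List (Fin r)) : wordRatio a I ≤ 1 := by
  simpa using wordRatio_le_pow_length h.pos (fun i => (h.ratio_lt_one i).le) I

theorem exists_word (h : IsSeparatedIFS K φ a) (N : ℕ) {x} (hx : x ∈ K) :
    ∃ I : List (Fin r), I.length = N ∧ x ∈ multiComp φ I '' K := by
  induction N generalizing x with
  | zero => exact ⟨[], rfl, x, hx, rfl⟩
  | succ N ih =>
    obtain ⟨i, y, hy, rfl⟩ := h.exists_preimage hx
    obtain ⟨I, hI, z, hz, rfl⟩ := ih hy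
    exact ⟨i :: I, by simp [hI], z, hz, rfl⟩

/-- At the first letter where the addresses differ, the gap is at least η times the ratio of the
common prefix, which is at least the ratio of `I`. -/
theorem le_dist_of_notMem_image (h : IsSeparatedIFS K φ a) {η : ℝ}
    (hη : 0 < η) (hsep : ∀ i j, i ≠ j → ∀ x ∈ K, ∀ y ∈ K, η ≤ dist (φ i x) (φ j y))
    (I : List (Fin r)) {x y} (hx : x ∈ multiComp φ I '' K) (hy : y ∈ K)
    (hyI : y ∉ multiComp φ I '' K) : η * wordRatio a I ≤ dist x y := by
  induction I generalizing x y with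
  | nil => exact (hyI ⟨y, hy, rfl⟩).elim
  | cons i I ih =>
    obtain ⟨x, hx, rfl⟩ := hx
    obtain ⟨j, y, hy', rfl⟩ := h.exists_preimage hy
    change _ ≤ dist (φ i (multiComp φ I x)) _
    by_cases hij : i = j
    · subst hij
      rw [(h.ratio i).2, wordRatio_cons, mul_left_comm]
      refine mul_le_mul_of_nonneg_left (ih ⟨x, hx, rfl⟩ hy' ?_) (h.pos i).le
      rintro ⟨z, hz, rfl⟩
      exact hyI ⟨z, hz, rfl⟩
    · exact (mul_le_of_le_one_right hη.le (h.wordRatio_le_one _)).trans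
        (hsep i j hij _ (h.multiComp_mem I hx) y hy')

/-- A set in a cylinder whose diameter is below η times the ratio cannot meet two children, so it
lies in one of them. `N` caps the descent, which would never stop for a single point. -/
theorem exists_cylinder_superset (h : IsSeparatedIFS K φ a) {η : ℝ}
    (hsep : ∀ i j, i ≠ j → ∀ x ∈ K, ∀ y ∈ K, η ≤ dist (φ i x) (φ j y))
    {U : Set (EuclideanSpace ℝ (Fin d))} (hU : U ⊆ K) (hne : U.Nonempty) (N : ℕ) :
    ∃ I : List (Fin r), U ⊆ multiComp φ I '' K ∧
      ((∃ x ∈ U, ∃ y ∈ U, η * wordRatio a I ≤ dist x y) ∨ I.length = N) := by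
  induction N with
  | zero => exact ⟨[], by simpa [multiComp] using hU, Or.inr rfl⟩
  | succ N ih =>
    obtain ⟨I, hI, hor⟩ := ih
    by_cases hl : ∃ x ∈ U, ∃ y ∈ U, η * wordRatio a I ≤ dist x y
    · exact ⟨I, hI, Or.inl hl⟩
    have hlen := hor.resolve_left hl
    push Not at hl
    obtain ⟨x, hx⟩ := hne
    obtain ⟨z, hz, rfl⟩ := hI hx
    obtain ⟨i, x', hx', rfl⟩ := h.exists_preimage hz
    refine ⟨I ++ [i], fun y hy => ?_, Or.inr (by simp [hlen])⟩
    obtain ⟨z', hz', rfl⟩ := hI hy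
    obtain ⟨j, y', hy', rfl⟩ := h.exists_preimage hz'
    have h1 := hl _ hx _ hy
    rw [(h.similitude I).2, mul_comm, mul_lt_mul_iff_left₀ (wordRatio_pos h.pos I)] at h1
    obtain rfl : i = j := by
      by_contra hij
      exact absurd h1 (not_lt.2 (hsep i j hij _ hx' _ hy'))
    rw [multiComp_append]
    exact ⟨y', hy', rfl⟩

end IsSeparatedIFS

/-! ### The similarity dimension and 0 < H^s(K) < ∞ -/

namespace IsSeparatedIFS

variable {d r : ℕ} {K : Set (EuclideanSpace ℝ (Fin d))}
  {φ : Fin r → EuclideanSpace ℝ (Fin d) → EuclideanSpace ℝ (Fin d)} {a : Fin r → ℝ}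

theorem exists_exponent (h : IsSeparatedIFS K φ a) : ∃ s : ℝ, 0 < s ∧ ∑ i, a i ^ s = 1 := by
  have hr := h.selfSimilar.two_le
  have hcont : Continuous fun s : ℝ => ∑ i, a i ^ s :=
    continuous_finsetSum _ fun i _ => Real.continuous_const_rpow (h.pos i).ne'
  have hlim : Tendsto (fun s : ℝ => ∑ i, a i ^ s) atTop (𝓝 0) := by
    simpa using tendsto_finsetSum Finset.univ fun i _ =>
      tendsto_rpow_atTop_of_base_lt_one (a i) (by linarith [h.pos i]) (h.ratio_lt_one i)
  obtain ⟨t, ht, ht0⟩ := ((hlim.eventually_lt_const one_pos).and (eventually_ge_atTop 0)).exists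
  have h0 : (2 : ℝ) ≤ ∑ i, a i ^ (0 : ℝ) := by simpa using hr
  obtain ⟨s, hs, hs1⟩ := intermediate_value_Icc' ht0 hcont.continuousOn
    (show (1 : ℝ) ∈ _ from ⟨ht.le, by linarith⟩)
  refine ⟨s, lt_of_le_of_ne hs.1 ?_, hs1⟩
  rintro rfl
  change ∑ i, a i ^ (0 : ℝ) = 1 at hs1
  linarith

theorem measure_image (h : IsSeparatedIFS K φ a) {s : ℝ} (hs : 0 < s) (I : List (Fin r))
    (A : Set (EuclideanSpace ℝ (Fin d))) :
    μH[s] (multiComp φ I '' A) = ENNReal.ofReal (wordRatio a I ^ s) * μH[s] A :=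
  (h.similitude I).hausdorffMeasure_image hs.le A

/-- The cylinders of level n cover K, and the s-th powers of their ratios add up to (Σ aᵢ^s)ⁿ = 1.
-/
theorem measure_ne_top (h : IsSeparatedIFS K φ a) {s : ℝ} (hs : 0 < s)
    (hsum : ∑ i, a i ^ s = 1) : μH[s] K ≠ ∞ := by
  obtain ⟨m, q, hm, -, hq0, hq1, hma, haq⟩ := h.exists_bounds
  have hD : ediam K ≠ ∞ := h.selfSimilar.isCompact.isBounded.ediam_ne_top
  have hdiam : ∀ I : List (Fin r),
      ediam (multiComp φ I '' K) ≤ ENNReal.ofReal (wordRatio a I) * ediam K := fun I =>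
    (h.similitude I).lipschitzWith.ediam_image_le K
  have key : μH[s] K ≤ liminf (fun n : ℕ => ∑ w : Fin n → Fin r,
      ediam (multiComp φ (List.ofFn w) '' K) ^ s) atTop := by
    refine hausdorffMeasure_le_liminf_sum s K (fun n => ENNReal.ofReal (q ^ n) * ediam K) ?_
      (fun n w => multiComp φ (List.ofFn w) '' K) ?_ ?_
    · have h1 : Tendsto (fun n : ℕ => ENNReal.ofReal (q ^ n)) atTop (𝓝 0) := by
        simpa using ENNReal.tendsto_ofReal (tendsto_pow_atTop_nhds_zero_of_lt_one hq0.le hq1)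
      simpa using ENNReal.Tendsto.mul_const h1 (Or.inr hD)
    · refine Eventually.of_forall fun n w => (hdiam _).trans ?_
      gcongr
      simpa using wordRatio_le_pow_length h.pos haq (List.ofFn w)
    · refine Eventually.of_forall fun n x hx => ?_
      obtain ⟨I, rfl, hI⟩ := h.exists_word n hx
      exact mem_iUnion.2 ⟨I.get, by rwa [List.ofFn_get]⟩
  have hbound : ∀ n : ℕ, ∑ w : Fin n → Fin r, ediam (multiComp φ (List.ofFn w) '' K) ^ s
      ≤ ediam K ^ s := fun n => by
    calc _ ≤ ∑ w : Fin n → Fin r, ENNReal.ofReal (∏ j, a (w j) ^ s) * ediam K ^ s := by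
          refine Finset.sum_le_sum fun w _ => ?_
          refine (ENNReal.rpow_le_rpow (hdiam _) hs.le).trans_eq ?_
          rw [ENNReal.mul_rpow_of_nonneg _ _ hs.le,
            ENNReal.ofReal_rpow_of_pos (wordRatio_pos h.pos _),
            Real.finsetProd_rpow _ _ fun i _ => (h.pos _).le]
          simp [wordRatio, List.map_ofFn, List.prod_ofFn]
      _ = ENNReal.ofReal (∑ w : Fin n → Fin r, ∏ j, a (w j) ^ s) * ediam K ^ s := by
          rw [← Finset.sum_mul, ENNReal.ofReal_sum_of_nonneg]
          exact fun w _ => Finset.prod_nonneg fun i _ => Real.rpow_nonneg (h.pos _).le _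
      _ = ediam K ^ s := by
          rw [← Fintype.sum_pow (fun i => a i ^ s), hsum]
          simp
  refine ne_top_of_le_ne_top (ENNReal.rpow_ne_top_of_nonneg hs.le hD) (key.trans ?_)
  exact liminf_le_of_frequently_le' (Frequently.of_forall hbound)

/-- Sort the words by first letter: stripping `i` from those that start with `i` leaves a cover of K
by shorter words, so by induction they contribute at least `a i ^ s`. -/
theorem one_le_sum_of_cover (h : IsSeparatedIFS K φ a) {s : ℝ}
    (hsum : ∑ i, a i ^ s = 1) {ι : Type*} (T : Finset ι) (w : ι → List (Fin r))
    (hcov : K ⊆ ⋃ n ∈ T, multiComp φ (w n) '' K) : 1 ≤ ∑ n ∈ T, wordRatio a (w n) ^ s := by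
  obtain ⟨N, hN⟩ : ∃ N, ∀ n ∈ T, (w n).length ≤ N :=
    ⟨T.sup fun n => (w n).length, fun n hn => Finset.le_sup (f := fun n => (w n).length) hn⟩
  have hnn : ∀ I : List (Fin r), 0 ≤ wordRatio a I ^ s := fun I =>
    Real.rpow_nonneg (wordRatio_pos h.pos I).le s
  induction N generalizing T w with
  | zero =>
    obtain ⟨x, hx⟩ := h.selfSimilar.nonempty
    obtain ⟨n, hn, -⟩ := mem_iUnion₂.1 (hcov hx)
    have hw : w n = [] := List.eq_nil_of_length_eq_zero (Nat.le_zero.1 (hN n hn))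
    refine le_trans ?_ (Finset.single_le_sum (fun n _ => hnn (w n)) hn)
    simp [hw]
  | succ N ih =>
    by_cases hnil : ∃ n ∈ T, w n = []
    · obtain ⟨n, hn, hw⟩ := hnil
      refine le_trans ?_ (Finset.single_le_sum (fun n _ => hnn (w n)) hn)
      simp [hw]
    push Not at hnil
    classical
    have hsplit : ∀ i, a i ^ s ≤
        ∑ n ∈ T with (w n).head? = some i, wordRatio a (w n) ^ s := fun i => by
      have htail : ∀ n ∈ T.filter fun n => (w n).head? = some i, w n = i :: (w n).tail :=
        fun n hn => List.eq_cons_of_mem_head? (by simpa using (Finset.mem_filter.1 hn).2)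
      have h1 := ih (T.filter fun n => (w n).head? = some i) (fun n => (w n).tail) ?_ ?_
      · calc a i ^ s ≤ a i ^ s * _ := le_mul_of_one_le_right (Real.rpow_nonneg (h.pos i).le s) h1
          _ = _ := by
            rw [Finset.mul_sum]
            refine Finset.sum_congr rfl fun n hn => ?_
            conv_rhs => rw [htail n hn]
            rw [wordRatio_cons, Real.mul_rpow (h.pos i).le (wordRatio_pos h.pos _).le]
      · intro x hx
        obtain ⟨n, hn, z, hz, hzx⟩ := mem_iUnion₂.1 (hcov (h.map_mem i hx))
        obtain ⟨j, J, hJ⟩ := List.exists_cons_of_ne_nil (hnil n hn)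
        rw [hJ] at hzx
        change φ j (multiComp φ J z) = φ i x at hzx
        obtain rfl : j = i := by
          by_contra hji
          exact h.map_ne hji (h.multiComp_mem J hz) hx hzx
        refine mem_iUnion₂.2 ⟨n, by simp [hn, hJ], z, hz, ?_⟩
        simpa [hJ] using (h.ratio j).injective hzx
      · intro n hn
        have := hN n (Finset.mem_filter.1 hn).1
        simp only [List.length_tail]
        omega
    have := Finset.sum_fiberwise T (fun n => (w n).head?) fun n => wordRatio a (w n) ^ s
    rw [← this, Fintype.sum_option, ← hsum]
    exact (Finset.sum_le_sum fun i _ => hsplit i).trans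
      (le_add_of_nonneg_left (Finset.sum_nonneg fun n _ => hnn _))

/-- Each covering set that meets K is replaced by a cylinder of ratio at most η⁻¹ times its
diameter, up to a summable error in the s-th powers; `one_le_sum_of_cover` then bounds the sum from
below. -/
theorem measure_ne_zero (h : IsSeparatedIFS K φ a) {s : ℝ} (hs : 0 < s)
    (hsum : ∑ i, a i ^ s = 1) : μH[s] K ≠ 0 := by
  obtain ⟨m, q, hm, -, hq0, hq1, hma, haq⟩ := h.exists_bounds
  obtain ⟨η, hη, hsep⟩ := h.exists_separation
  set C : ℝ≥0∞ := ENNReal.ofReal (η⁻¹ ^ s)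
  obtain ⟨δ, hδ, hδsum⟩ := ENNReal.exists_pos_sum_of_countable (ε := 2⁻¹) (by simp) ℕ
  have key : (2 * C)⁻¹ ≤ μH[s] K := by
    rw [hausdorffMeasure_apply]
    -- At scale `∞` diameters are unrestricted: the bound is on Hausdorff content.
    refine le_iSup₂_of_le ∞ ENNReal.coe_lt_top (le_iInf₂ fun t ht => le_iInf fun _ => ?_)
    set A := ∑' n, ⨆ _ : (t n).Nonempty, ediam (t n) ^ s
    have hword : ∀ n : {n // (t n ∩ K).Nonempty}, ∃ I : List (Fin r),
        t n ∩ K ⊆ multiComp φ I '' K ∧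
        ENNReal.ofReal (wordRatio a I ^ s) ≤ C * ediam (t n) ^ s + δ n := fun ⟨n, hn⟩ => by
      obtain ⟨N, hN⟩ : ∃ N : ℕ, (q ^ s) ^ N < δ n :=
        exists_pow_lt_of_lt_one (hδ n) (Real.rpow_lt_one hq0.le hq1 hs)
      obtain ⟨I, hI, ⟨x, hx, y, hy, hxy⟩ | hlen⟩ :=
        h.exists_cylinder_superset hsep (inter_subset_right (s := t n)) hn N
      · refine ⟨I, hI, le_add_right ?_⟩
        have hw := wordRatio_pos h.pos I
        calc ENNReal.ofReal (wordRatio a I ^ s) ≤ ENNReal.ofReal ((η⁻¹ * dist x y) ^ s) := by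
              refine ENNReal.ofReal_le_ofReal (Real.rpow_le_rpow hw.le ?_ hs.le)
              rwa [inv_mul_eq_div, le_div_iff₀' hη]
          _ = C * edist x y ^ s := by
              rw [Real.mul_rpow (by positivity) dist_nonneg, ENNReal.ofReal_mul (by positivity),
                edist_dist, ENNReal.ofReal_rpow_of_nonneg dist_nonneg hs.le]
          _ ≤ _ := by gcongr; exact edist_le_ediam_of_mem hx.1 hy.1
      · refine ⟨I, hI, le_add_left ?_⟩
        rw [← ENNReal.ofReal_coe_nnreal]
        refine ENNReal.ofReal_le_ofReal (le_trans ?_ hN.le)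
        rw [← Real.rpow_mul_natCast hq0.le, mul_comm, Real.rpow_mul hq0.le, Real.rpow_natCast]
        refine Real.rpow_le_rpow (wordRatio_pos h.pos I).le ?_ hs.le
        simpa [hlen] using wordRatio_le_pow_length h.pos haq I
    choose w hw hwle using hword
    -- Thickening by η times the ratio makes the cylinders open without adding points of K.
    obtain ⟨T, hT⟩ := h.selfSimilar.isCompact.elim_finite_subcover
      (fun n => thickening (η * wordRatio a (w n)) (multiComp φ (w n) '' K))
      (fun n => isOpen_thickening) (fun x hx => by
        obtain ⟨n, hn⟩ := mem_iUnion.1 (ht hx)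
        have : (t n ∩ K).Nonempty := ⟨x, hn, hx⟩
        exact mem_iUnion.2 ⟨⟨n, this⟩, self_subset_thickening
          (mul_pos hη (wordRatio_pos h.pos _)) _ (hw ⟨n, this⟩ ⟨hn, hx⟩)⟩)
    have h1 : 1 ≤ ∑ n ∈ T, wordRatio a (w n) ^ s := by
      refine h.one_le_sum_of_cover hsum T w fun x hx => ?_
      obtain ⟨n, hn, hxn⟩ := mem_iUnion₂.1 (hT hx)
      refine mem_iUnion₂.2 ⟨n, hn, ?_⟩
      by_contra hxI
      obtain ⟨z, hz, hxz⟩ := mem_thickening_iff.1 hxn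
      rw [dist_comm] at hxz
      exact absurd hxz (not_lt.2 (h.le_dist_of_notMem_image hη hsep _ hz hx hxI))
    have h2 : (1 : ℝ≥0∞) ≤ C * A + 2⁻¹ := by
      calc (1 : ℝ≥0∞) ≤ ENNReal.ofReal (∑ n ∈ T, wordRatio a (w n) ^ s) := by simpa using h1
        _ = ∑ n ∈ T, ENNReal.ofReal (wordRatio a (w n) ^ s) :=
            ENNReal.ofReal_sum_of_nonneg fun n _ =>
              Real.rpow_nonneg (wordRatio_pos h.pos _).le s
        _ ≤ ∑ n ∈ T, (C * (⨆ _ : (t n).Nonempty, ediam (t n) ^ s) + δ n) := by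
            refine Finset.sum_le_sum fun n _ => (hwle n).trans ?_
            gcongr
            exact le_iSup_of_le n.2.left le_rfl
        _ ≤ ∑' n : {n // (t n ∩ K).Nonempty},
              (C * (⨆ _ : (t n).Nonempty, ediam (t n) ^ s) + δ n) := ENNReal.sum_le_tsum T
        _ ≤ ∑' n, (C * (⨆ _ : (t n).Nonempty, ediam (t n) ^ s) + δ n) :=
            ENNReal.tsum_comp_le_tsum_of_injective Subtype.val_injective
              (fun n => C * (⨆ _ : (t n).Nonempty, ediam (t n) ^ s) + (δ n : ℝ≥0∞))
        _ ≤ C * A + 2⁻¹ := by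
            rw [ENNReal.tsum_add, ENNReal.tsum_mul_left]
            gcongr
    have h3 : 2⁻¹ ≤ C * A := by
      by_contra! hlt
      have := ENNReal.add_lt_add_right (a := 2⁻¹) (by simp) hlt
      rw [ENNReal.inv_two_add_inv_two] at this
      exact absurd h2 (not_le.2 this)
    rw [ENNReal.mul_inv (by simp) (by simp), ← div_eq_mul_inv]
    exact ENNReal.div_le_of_le_mul (by rwa [mul_comm])
  intro h0
  rw [h0] at key
  simp [C, ENNReal.mul_eq_top] at key

end IsSeparatedIFS

/-! ### Rigidity of similitudes close to the identity -/

theorem IsSimilitudeWithRatio.norm_linear {d : ℕ}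
    {f : EuclideanSpace ℝ (Fin d) → EuclideanSpace ℝ (Fin d)} {ρ : ℝ}
    (hf : IsSimilitudeWithRatio f ρ)
    {L : EuclideanSpace ℝ (Fin d) →L[ℝ] EuclideanSpace ℝ (Fin d)} {v : EuclideanSpace ℝ (Fin d)}
    (hL : ∀ x, f x = L x + v) (u : EuclideanSpace ℝ (Fin d)) : ‖L u‖ = ρ * ‖u‖ := by
  simpa [hL, dist_eq_norm] using hf.2 u 0

/-- A linear map that is bounded on the differences of a set is Lipschitz on that set, with a
constant that depends on the set only. -/
theorem exists_norm_sub_le_of_bounded {E F : Type*} [NormedAddCommGroup E] [NormedSpace ℝ E]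
    [FiniteDimensional ℝ E] [NormedAddCommGroup F] [NormedSpace ℝ F] (K : Set E) :
    ∃ C > 0, ∀ (M : E →L[ℝ] F) (δ : ℝ), 0 ≤ δ → (∀ x ∈ K, ∀ y ∈ K, ‖M (x - y)‖ ≤ δ) →
      ∀ x ∈ K, ∀ y ∈ K, ‖M (x - y)‖ ≤ C * δ * ‖x - y‖ := by
  let S : Set E := {u | ∃ x ∈ K, ∃ y ∈ K, u = x - y}
  -- The basis consists of differences of points of K, so `M` is bounded by δ on it, while the
  -- coordinate functionals depend on K only.
  obtain ⟨b, hbS, hspan, hli⟩ := exists_linearIndependent ℝ S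
  let B := Module.Basis.span hli
  have hrange : Submodule.span ℝ (range ((↑) : b → E)) = Submodule.span ℝ S := by
    rw [Subtype.range_coe, hspan]
  have : Fintype b := hli.setFinite.fintype
  let c : b → (Submodule.span ℝ (range ((↑) : b → E)) →L[ℝ] ℝ) := fun i =>
    LinearMap.toContinuousLinearMap (B.coord i)
  refine ⟨∑ i, ‖c i‖ + 1, by positivity, fun M δ hδ hM x hx y hy => ?_⟩
  have hmem : x - y ∈ Submodule.span ℝ (range ((↑) : b → E)) := by
    rw [hrange]
    exact Submodule.subset_span ⟨x, hx, y, hy, rfl⟩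
  have hsum : x - y = ∑ i, c i ⟨x - y, hmem⟩ • (i : E) := by
    have := congrArg Subtype.val (B.sum_repr ⟨x - y, hmem⟩)
    simp only [AddSubmonoidClass.coe_finsetSum, Submodule.coe_smul] at this
    refine this.symm.trans (Finset.sum_congr rfl fun i _ => ?_)
    rw [Module.Basis.span_apply]
    simp [c, B]
  calc ‖M (x - y)‖ = ‖∑ i, c i ⟨x - y, hmem⟩ • M (i : E)‖ := by
        conv_lhs => rw [hsum]
        simp
    _ ≤ ∑ i, ‖c i‖ * ‖x - y‖ * δ := by
        refine norm_sum_le_of_le _ fun i _ => ?_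
        rw [norm_smul]
        obtain ⟨z, hz, z', hz', hi⟩ := hbS i.2
        exact mul_le_mul ((c i).le_opNorm _) (hi ▸ hM z hz z' hz') (norm_nonneg _) (by positivity)
    _ = (∑ i, ‖c i‖) * δ * ‖x - y‖ := by
        rw [Finset.sum_mul, Finset.sum_mul]
        exact Finset.sum_congr rfl fun i _ => by ring
    _ ≤ _ := by gcongr; linarith

namespace IsSeparatedIFS

variable {d r : ℕ} {K : Set (EuclideanSpace ℝ (Fin d))}
  {φ : Fin r → EuclideanSpace ℝ (Fin d) → EuclideanSpace ℝ (Fin d)} {a : Fin r → ℝ}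

theorem exists_dist_le (h : IsSeparatedIFS K φ a) : ∃ D > 0, ∀ x ∈ K, ∀ y ∈ K, dist x y ≤ D :=
  ⟨diam K + 1, by positivity, fun _ hx _ hy =>
    (dist_le_diam_of_mem h.selfSimilar.isCompact.isBounded hx hy).trans (by linarith)⟩

theorem exists_pow_mul_lt {q D c : ℝ} (hq1 : q < 1) (hc : 0 < c) (hD : 0 < D) :
    ∃ n : ℕ, q ^ n * D < c := by
  obtain ⟨n, hn⟩ := exists_pow_lt_of_lt_one (div_pos hc hD) hq1
  exact ⟨n, (lt_div_iff₀ hD).1 hn⟩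

/-- A map that is close to a translation by a vector that is not too small misses a substantial
part of `K`. -/
theorem exists_le_measure_diff_image (h : IsSeparatedIFS K φ a) {s : ℝ} (hs : 0 < s) {c : ℝ}
    (hc : 0 < c) : ∃ κ > 0, ∀ (g : EuclideanSpace ℝ (Fin d) → EuclideanSpace ℝ (Fin d))
      (w : EuclideanSpace ℝ (Fin d)), c ≤ ‖w‖ → (∀ x ∈ K, ‖g x - x - w‖ < c / 2) →
      ENNReal.ofReal κ * μH[s] K ≤ μH[s] (K \ g '' K) := by
  obtain ⟨m, q, hm, -, hq0, hq1, hma, haq⟩ := h.exists_bounds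
  obtain ⟨D, hD, hdist⟩ := h.exists_dist_le
  obtain ⟨N, hN⟩ := exists_pow_mul_lt hq1 (half_pos hc) hD
  refine ⟨(m ^ N) ^ s, by positivity, fun g w hw hg => ?_⟩
  -- On K, `g` raises ⟨·, w⟩ by more than c‖w‖/2, so `g '' K` misses every point within c/2 of the
  -- minimizer.
  obtain ⟨x₀, hx₀, hmin⟩ := h.selfSimilar.isCompact.exists_isMinOn h.selfSimilar.nonempty
    (f := fun x => inner ℝ x w) (by fun_prop)
  rw [isMinOn_iff] at hmin
  obtain ⟨J, hJ, z₀, hz₀, rfl⟩ := h.exists_word N hx₀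
  have hsub : multiComp φ J '' K ⊆ K \ g '' K := by
    rintro _ ⟨z, hz, rfl⟩
    refine ⟨h.multiComp_mem J hz, ?_⟩
    rintro ⟨x, hx, hxz⟩
    have h1 : ‖multiComp φ J z - multiComp φ J z₀‖ < c / 2 := by
      rw [← dist_eq_norm, (h.similitude J).2]
      refine lt_of_le_of_lt (mul_le_mul ?_ (hdist z hz z₀ hz₀) dist_nonneg (by positivity)) hN
      simpa [hJ] using wordRatio_le_pow_length h.pos haq J
    have hw0 : 0 < ‖w‖ := hc.trans_le hw
    have h2 := abs_le.1 (abs_real_inner_le_norm (multiComp φ J z - multiComp φ J z₀) w)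
    have h3 := abs_le.1 (abs_real_inner_le_norm (g x - x - w) w)
    have h4 := hmin x hx
    have h5 := mul_lt_mul_of_pos_right h1 hw0
    have h6 := mul_lt_mul_of_pos_right (hg x hx) hw0
    rw [hxz] at h6
    have h7 := mul_le_mul_of_nonneg_right hw hw0.le
    rw [inner_sub_left] at h2
    rw [inner_sub_left, inner_sub_left, real_inner_self_eq_norm_mul_norm, hxz] at h3
    linarith [h2.1, h2.2, h3.1, h3.2]
  refine le_trans ?_ (measure_mono hsub)
  rw [h.measure_image hs]
  gcongr
  simpa [hJ] using pow_length_le_wordRatio hm hma J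

/-- The fraction of a cylinder outside `B` is the average, with weights `a i ^ s`, of those of its
children, so some child does no worse. -/
theorem exists_child_measure_diff_le (h : IsSeparatedIFS K φ a) {s : ℝ}
    (hsum : ∑ i, a i ^ s = 1) {B : Set (EuclideanSpace ℝ (Fin d))} (hB : MeasurableSet B) {t : ℝ}
    (ht : 0 ≤ t) {I : List (Fin r)}
    (hI : μH[s] (multiComp φ I '' K \ B) ≤ ENNReal.ofReal (t * wordRatio a I ^ s) * μH[s] K) :
    ∃ i, μH[s] (multiComp φ (I ++ [i]) '' K \ B) ≤
      ENNReal.ofReal (t * wordRatio a (I ++ [i]) ^ s) * μH[s] K := by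
  by_contra! hlt
  have hw := wordRatio_pos h.pos I
  have hne : (Finset.univ : Finset (Fin r)).Nonempty := by
    obtain ⟨x, hx⟩ := h.selfSimilar.nonempty
    exact ⟨(h.exists_preimage hx).choose, Finset.mem_univ _⟩
  have h1 := ENNReal.sum_lt_sum_of_nonempty hne fun i _ => hlt i
  have hdisj : Pairwise (Function.onFun Disjoint fun i => multiComp φ (I ++ [i]) '' K \ B) := by
    intro i j hij
    refine Disjoint.mono sdiff_subset sdiff_subset ?_
    simp only [multiComp_append, image_comp]
    exact (disjoint_image_iff (h.similitude I).injective).2 (h.separated i j hij)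
  have h2 : ∑ i, μH[s] (multiComp φ (I ++ [i]) '' K \ B) = μH[s] (multiComp φ I '' K \ B) := by
    rw [h.image_eq_iUnion I, iUnion_sdiff, measure_iUnion hdisj fun i =>
      (h.isCompact_image _).measurableSet.diff hB, tsum_fintype]
  have h3 : ∑ i, ENNReal.ofReal (t * wordRatio a (I ++ [i]) ^ s) * μH[s] K =
      ENNReal.ofReal (t * wordRatio a I ^ s) * μH[s] K := by
    rw [← Finset.sum_mul, ← ENNReal.ofReal_sum_of_nonneg, ← Finset.mul_sum]
    · congr 3
      calc _ = ∑ i, wordRatio a I ^ s * a i ^ s := by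
            refine Finset.sum_congr rfl fun i _ => ?_
            rw [wordRatio_append, Real.mul_rpow hw.le (wordRatio_pos h.pos _).le]
            simp
        _ = _ := by rw [← Finset.mul_sum, hsum, mul_one]
    · exact fun i _ => mul_nonneg ht (Real.rpow_nonneg (wordRatio_pos h.pos _).le _)
  rw [h2, h3] at h1
  exact absurd hI (not_le.2 h1)

/-- Descend through good children until the ratio passes θ; one step costs at most a factor `m`. -/
theorem exists_descendant_measure_diff_le (h : IsSeparatedIFS K φ a) {s : ℝ}
    (hsum : ∑ i, a i ^ s = 1) {B : Set (EuclideanSpace ℝ (Fin d))} (hB : MeasurableSet B) {t : ℝ}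
    (ht : 0 ≤ t) {P : List (Fin r)}
    (hP : μH[s] (multiComp φ P '' K \ B) ≤ ENNReal.ofReal (t * wordRatio a P ^ s) * μH[s] K)
    {m : ℝ} (hm0 : 0 < m) (hm : ∀ i, m ≤ a i) {θ : ℝ} (hθ : 0 < θ) (hθP : θ ≤ wordRatio a P) :
    ∃ I, multiComp φ I '' K ⊆ multiComp φ P '' K ∧
      μH[s] (multiComp φ I '' K \ B) ≤ ENNReal.ofReal (t * wordRatio a I ^ s) * μH[s] K ∧
      m * θ ≤ wordRatio a I ∧ wordRatio a I ≤ θ := by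
  obtain ⟨-, q, -, -, hq0, hq1, -, haq⟩ := h.exists_bounds
  obtain ⟨n, hn⟩ := exists_pow_lt_of_lt_one hθ hq1
  have key : ∀ k, ∃ I, multiComp φ I '' K ⊆ multiComp φ P '' K ∧
      μH[s] (multiComp φ I '' K \ B) ≤ ENNReal.ofReal (t * wordRatio a I ^ s) * μH[s] K ∧
      ((m * θ ≤ wordRatio a I ∧ wordRatio a I ≤ θ) ∨ (k ≤ I.length ∧ θ ≤ wordRatio a I)) := by
    intro k
    induction k with
    | zero => exact ⟨P, subset_rfl, hP, Or.inr ⟨Nat.zero_le _, hθP⟩⟩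
    | succ k ih =>
      obtain ⟨I, hIP, hI, hor | ⟨hk, hθI⟩⟩ := ih
      · exact ⟨I, hIP, hI, Or.inl hor⟩
      obtain ⟨i, hi⟩ := h.exists_child_measure_diff_le hsum hB ht hI
      have hsub : multiComp φ (I ++ [i]) '' K ⊆ multiComp φ I '' K := by
        rw [h.image_eq_iUnion I]
        exact subset_iUnion (fun i => multiComp φ (I ++ [i]) '' K) i
      refine ⟨I ++ [i], hsub.trans hIP, hi, ?_⟩
      rcases le_total θ (wordRatio a (I ++ [i])) with hle | hle
      · exact Or.inr ⟨by simpa using hk, hle⟩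
      · refine Or.inl ⟨?_, hle⟩
        rw [wordRatio_append, wordRatio_cons, wordRatio_nil, mul_one, mul_comm]
        exact mul_le_mul hθI (hm i) hm0.le (wordRatio_pos h.pos I).le
  obtain ⟨I, hIP, hI, hor | ⟨hk, hθI⟩⟩ := key n
  · exact ⟨I, hIP, hI, hor⟩
  · have h1 := wordRatio_le_pow_length h.pos haq I
    have h2 := pow_le_pow_of_le_one hq0.le hq1.le hk
    linarith

/-- A similitude that is close to the identity on `K` and whose image of `K` covers almost all of
`K` is the identity on `K`. -/
theorem exists_rigidity (h : IsSeparatedIFS K φ a) {s : ℝ} (hs : 0 < s)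
    (hsum : ∑ i, a i ^ s = 1) :
    ∃ ε > 0, ∀ (g : EuclideanSpace ℝ (Fin d) → EuclideanSpace ℝ (Fin d)) (ρ : ℝ),
      IsSimilitudeWithRatio g ρ → (∀ x ∈ K, dist (g x) x ≤ ε) →
      μH[s] (K \ g '' K) ≤ ENNReal.ofReal ε * μH[s] K → EqOn g id K := by
  obtain ⟨m, q, hm, -, hq0, hq1, hma, haq⟩ := h.exists_bounds
  obtain ⟨η, hη, hsep⟩ := h.exists_separation
  obtain ⟨D, hD, hdist⟩ := h.exists_dist_le
  obtain ⟨C, hC, hlip⟩ := exists_norm_sub_le_of_bounded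
    (F := EuclideanSpace ℝ (Fin d)) K
  obtain ⟨ℓ, hℓ⟩ := exists_pow_mul_lt (c := 1 / (4 * C)) hq1 (by positivity) hD
  -- The descent will end at a ratio between m·κδ = 2δ/η and κδ. The lower end keeps outside points
  -- from entering the cylinder; the upper makes the rescaled displacement at least (δ/2)/(κδ) = c.
  set κ := 2 / (m * η) with hκ
  set c := 1 / (2 * κ) with hc
  obtain ⟨t, ht, hmiss⟩ := h.exists_le_measure_diff_image hs (c := c) (by positivity)
  -- In order: room in `P` to descend to size κδ; rescaled displacement varying by less than c/2;
  -- missed fraction of `P` at most t/2.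
  set ε := min (m ^ ℓ / κ) (min (c / (8 * C * D)) (t / 2 * (m ^ ℓ) ^ s))
  have hε1 : κ * ε ≤ m ^ ℓ := by
    rw [← le_div_iff₀' (by positivity)]
    exact min_le_left _ _
  have hε2 : ε * (8 * C * D) ≤ c := by
    rw [← le_div_iff₀ (by positivity)]
    exact (min_le_right _ _).trans (min_le_left _ _)
  have hε3 : ε ≤ t / 2 * (m ^ ℓ) ^ s := (min_le_right _ _).trans (min_le_right _ _)
  refine ⟨ε, by positivity, fun g ρ hg hgε hgμ => ?_⟩
  obtain ⟨L, v, hL⟩ := hg.exists_affine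
  obtain ⟨x₀, hx₀, hmax⟩ := h.selfSimilar.isCompact.exists_isMaxOn h.selfSimilar.nonempty
    (f := fun x => dist (g x) x) (hg.continuous.dist continuous_id).continuousOn
  rw [isMaxOn_iff] at hmax
  set δ := dist (g x₀) x₀
  rcases (dist_nonneg : 0 ≤ δ).eq_or_lt with hδ | hδ
  · exact fun x hx => dist_le_zero.1 ((hmax x hx).trans hδ.ge)
  exfalso
  have hδε : δ ≤ ε := hgε x₀ hx₀
  have hdisp : ∀ x ∈ K, ∀ y ∈ K, ‖(g x - x) - (g y - y)‖ ≤ 2 * C * δ * dist x y := by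
    have h1 : ∀ x y, (g x - x) - (g y - y) = (L - 1) (x - y) := fun x y => by
      simp [hL]; abel
    intro x hx y hy
    rw [h1, dist_eq_norm]
    refine (hlip (L - 1) (2 * δ) (by positivity) (fun x hx y hy => ?_) x hx y hy).trans_eq (by ring)
    rw [← h1]
    refine (norm_sub_le _ _).trans ?_
    rw [← dist_eq_norm, ← dist_eq_norm, two_mul]
    exact add_le_add (hmax x hx) (hmax y hy)
  -- By the choice of ℓ, the displacement stays at least δ/2 on the cylinder `P` around the point of
  -- largest displacement.
  obtain ⟨P, hP, z₀, hz₀, hz₀x⟩ := h.exists_word ℓ hx₀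
  have hPdisp : ∀ y ∈ multiComp φ P '' K, δ / 2 ≤ ‖g y - y‖ := by
    rintro _ ⟨z, hz, rfl⟩
    have h1 := hdisp _ hx₀ _ (h.multiComp_mem P hz)
    have h2 : dist x₀ (multiComp φ P z) ≤ 1 / (4 * C) := by
      rw [← hz₀x, (h.similitude P).2]
      refine (mul_le_mul ?_ (hdist _ hz₀ _ hz) dist_nonneg (by positivity)).trans hℓ.le
      simpa [hP] using wordRatio_le_pow_length h.pos haq P
    have h3 : 2 * C * δ * dist x₀ (multiComp φ P z) ≤ δ / 2 := by
      refine (mul_le_mul_of_nonneg_left h2 (by positivity)).trans_eq ?_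
      field_simp
      ring
    have h4 := norm_sub_norm_le (g x₀ - x₀) (g (multiComp φ P z) - multiComp φ P z)
    rw [← dist_eq_norm (g x₀)] at h4
    change δ - _ ≤ _ at h4
    linarith
  have hmP : m ^ ℓ ≤ wordRatio a P := by
    simpa [hP] using pow_length_le_wordRatio hm hma P
  have hPμ : μH[s] (multiComp φ P '' K \ g '' K) ≤
      ENNReal.ofReal (t / 2 * wordRatio a P ^ s) * μH[s] K := by
    refine (measure_mono (sdiff_subset_sdiff_left (h.image_subset P))).trans (hgμ.trans ?_)
    gcongr
    exact hε3.trans (by gcongr)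
  have hgm : MeasurableSet (g '' K) :=
    (h.selfSimilar.isCompact.image hg.continuous).measurableSet
  obtain ⟨I, hIP, hIμ, hI1, hI2⟩ := h.exists_descendant_measure_diff_le hsum hgm
    (by positivity) hPμ hm hma (θ := κ * δ) (by positivity)
    (le_trans (by gcongr) (hε1.trans hmP))
  have hI := h.similitude I
  obtain ⟨LI, vI, hLI⟩ := hI.exists_affine
  set w := wordRatio a I
  obtain ⟨ψ, hψ, hψl, hψr⟩ := hI.exists_inverse
  have hwδ : δ < η * w := by
    have : 2 * δ / η ≤ w := by
      refine le_trans (le_of_eq ?_) hI1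
      rw [hκ]; field_simp
    rw [div_le_iff₀ hη] at this
    linarith
  -- Conjugation by `multiComp φ I` magnifies displacements by 1/w.
  set f : EuclideanSpace ℝ (Fin d) → EuclideanSpace ℝ (Fin d) := fun x => ψ (g (multiComp φ I x))
  have hfdisp : ∀ x, LI (f x - x) = g (multiComp φ I x) - multiComp φ I x := fun x => by
    rw [← hψr (g (multiComp φ I x))]
    simp only [f]
    rw [hLI (ψ _), hLI x, map_sub]
    abel
  -- Since δ < ηw, `g` moves no point of K from outside the cylinder onto one of its points.
  have hsubset : multiComp φ I '' (K \ f '' K) ⊆ multiComp φ I '' K \ g '' K := by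
    rintro _ ⟨x, ⟨hx, hxf⟩, rfl⟩
    refine ⟨⟨x, hx, rfl⟩, ?_⟩
    rintro ⟨y, hy, hyx⟩
    by_cases hyI : y ∈ multiComp φ I '' K
    · obtain ⟨z, hz, rfl⟩ := hyI
      exact hxf ⟨z, hz, by simp only [f]; rw [hyx, hψl]⟩
    · have h1 := h.le_dist_of_notMem_image hη hsep I ⟨x, hx, rfl⟩ hy hyI
      have h2 := hmax y hy
      rw [hyx] at h2
      linarith
  obtain ⟨p, hp⟩ := h.selfSimilar.nonempty
  have hmiss' := hmiss f (f p - p) ?_ ?_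
  · have h1 : ENNReal.ofReal (w ^ s) * (ENNReal.ofReal t * μH[s] K) ≤
        ENNReal.ofReal (t / 2 * w ^ s) * μH[s] K :=
      calc _ ≤ ENNReal.ofReal (w ^ s) * μH[s] (K \ f '' K) := by gcongr
        _ = μH[s] (multiComp φ I '' (K \ f '' K)) := (h.measure_image hs I _).symm
        _ ≤ _ := (measure_mono hsubset).trans hIμ
    have hw := hI.1
    rw [← mul_assoc, ← ENNReal.ofReal_mul (by positivity), ENNReal.mul_le_mul_iff_left
      (h.measure_ne_zero hs hsum) (h.measure_ne_top hs hsum),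
      ENNReal.ofReal_le_ofReal_iff (by positivity)] at h1
    have : 0 < w ^ s := by positivity
    nlinarith
  · have h1 : δ / 2 ≤ w * ‖f p - p‖ := by
      rw [← hI.norm_linear hLI, hfdisp]
      exact hPdisp _ (hIP ⟨p, hp, rfl⟩)
    have h2 := h1.trans (mul_le_mul_of_nonneg_right hI2 (norm_nonneg _))
    rw [hc, div_le_iff₀ (by positivity)]
    nlinarith
  · intro x hx
    have hw := hI.1
    have h1 : w * ‖f x - x - (f p - p)‖ ≤ w * (2 * C * δ * D) := by
      rw [← hI.norm_linear hLI, map_sub, hfdisp, hfdisp]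
      refine (hdisp _ (h.multiComp_mem I hx) _ (h.multiComp_mem I hp)).trans ?_
      rw [hI.2]
      calc 2 * C * δ * (w * dist x p) ≤ 2 * C * δ * (w * D) := by
            gcongr; exact hdist x hx p hp
        _ = _ := by ring
    have h2 := le_of_mul_le_mul_left h1 hw
    have h3 : δ * (8 * C * D) ≤ c := (by gcongr : _ ≤ ε * (8 * C * D)).trans hε2
    have hc0 : 0 < c := by positivity
    linarith

end IsSeparatedIFS

/-! ### Compactness and finiteness of the similitudes of K into itself -/

namespace IsSeparatedIFS

variable {d r : ℕ} {K : Set (EuclideanSpace ℝ (Fin d))}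
  {φ : Fin r → EuclideanSpace ℝ (Fin d) → EuclideanSpace ℝ (Fin d)} {a : Fin r → ℝ}

theorem ratio_le_one_of_mapsTo (h : IsSeparatedIFS K φ a)
    {f : EuclideanSpace ℝ (Fin d) → EuclideanSpace ℝ (Fin d)} {ρ : ℝ}
    (hf : IsSimilitudeWithRatio f ρ) (hfK : MapsTo f K K) : ρ ≤ 1 := by
  have hK := h.selfSimilar.isCompact
  obtain ⟨x, hx, y, hy, hxy⟩ := h.exists_ne
  obtain ⟨z, hz, hmax⟩ := (hK.prod hK).exists_isMaxOn ⟨(x, y), hx, hy⟩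
    (f := fun z => dist z.1 z.2) (by fun_prop)
  rw [isMaxOn_iff] at hmax
  have h1 : dist x y ≤ dist z.1 z.2 := hmax (x, y) ⟨hx, hy⟩
  have h2 : dist (f z.1) (f z.2) ≤ dist z.1 z.2 := hmax (f z.1, f z.2) ⟨hfK hz.1, hfK hz.2⟩
  rw [hf.2] at h2
  exact (mul_le_iff_le_one_left ((dist_pos.2 hxy).trans_le h1)).1 h2

/-- Similitudes mapping `K` into itself with ratios bounded below form a sequentially compact
family. -/
theorem exists_subseq_tendsto (h : IsSeparatedIFS K φ a) {c : ℝ} (hc : 0 < c)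
    {f : ℕ → EuclideanSpace ℝ (Fin d) → EuclideanSpace ℝ (Fin d)} {ρ : ℕ → ℝ}
    (hf : ∀ n, IsSimilitudeWithRatio (f n) (ρ n)) (hcρ : ∀ n, c ≤ ρ n)
    (hfK : ∀ n, MapsTo (f n) K K) :
    ∃ (σ : ℕ → ℕ) (g : EuclideanSpace ℝ (Fin d) → EuclideanSpace ℝ (Fin d)) (ρ₀ : ℝ),
      StrictMono σ ∧ IsSimilitudeWithRatio g ρ₀ ∧ MapsTo g K K ∧
      Tendsto (fun n => ρ (σ n)) atTop (𝓝 ρ₀) ∧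
      TendstoUniformlyOn (fun n => f (σ n)) g atTop K := by
  -- The pairs (L, v) are bounded because ratios are at most 1 and K is bounded; `c` keeps the limit
  -- ratio positive.
  choose L v hL using fun n => (hf n).exists_affine
  obtain ⟨x, hx, y, hy, hxy⟩ := h.exists_ne
  obtain ⟨R, hR0, hR⟩ := h.selfSimilar.isCompact.isBounded.exists_pos_norm_le
  have hL1 : ∀ n, ‖L n‖ ≤ 1 := fun n => (L n).opNorm_le_bound zero_le_one fun u => by
    rw [(hf n).norm_linear (hL n)]
    exact mul_le_mul_of_nonneg_right (h.ratio_le_one_of_mapsTo (hf n) (hfK n)) (norm_nonneg _)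
  have hv : ∀ n, ‖v n‖ ≤ R + R := fun n => by
    have : v n = f n x - L n x := by simp [hL]
    rw [this]
    refine (norm_sub_le _ _).trans (add_le_add (hR _ (hfK n hx)) ?_)
    exact ((L n).le_of_opNorm_le (hL1 n) x).trans (by simpa using hR x hx)
  obtain ⟨⟨L₀, v₀⟩, -, σ, hσ, hlim⟩ := ((isCompact_closedBall
    (0 : EuclideanSpace ℝ (Fin d) →L[ℝ] EuclideanSpace ℝ (Fin d)) 1).prod
    (isCompact_closedBall (0 : EuclideanSpace ℝ (Fin d)) (R + R))).tendsto_subseq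
    (x := fun n => (L n, v n)) fun n => ⟨by simpa using hL1 n, by simpa using hv n⟩
  rw [Prod.tendsto_iff] at hlim
  obtain ⟨hlimL, hlimv⟩ := hlim
  change Tendsto (fun n => L (σ n)) atTop (𝓝 L₀) at hlimL
  change Tendsto (fun n => v (σ n)) atTop (𝓝 v₀) at hlimv
  set g : EuclideanSpace ℝ (Fin d) → EuclideanSpace ℝ (Fin d) := fun x => L₀ x + v₀
  have hpt : ∀ x, Tendsto (fun n => f (σ n) x) atTop (𝓝 (g x)) := fun x => by
    simp only [hL]
    exact (((ContinuousLinearMap.apply ℝ _ x).continuous.tendsto L₀).comp hlimL).add hlimv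
  have hdist : ∀ x y, Tendsto (fun n => ρ (σ n) * dist x y) atTop (𝓝 (dist (g x) (g y))) :=
    fun x y => by simpa only [(hf _).2] using (hpt x).dist (hpt y)
  have hρ : Tendsto (fun n => ρ (σ n)) atTop (𝓝 (dist (g x) (g y) / dist x y)) := by
    have := (hdist x y).div_const (dist x y)
    simpa only [mul_div_cancel_right₀ _ (dist_pos.2 hxy).ne'] using this
  refine ⟨σ, g, _, hσ, ⟨hc.trans_le (ge_of_tendsto' hρ fun n => hcρ _), fun x' y' =>
    tendsto_nhds_unique (hdist x' y') (hρ.mul_const _)⟩, fun x hx =>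
    h.selfSimilar.isCompact.isClosed.mem_of_tendsto (hpt x)
      (Eventually.of_forall fun n => hfK _ hx), hρ, ?_⟩
  rw [Metric.tendstoUniformlyOn_iff]
  intro ε hε
  have hsmall : Tendsto (fun n => ‖L₀ - L (σ n)‖ * R + ‖v₀ - v (σ n)‖) atTop (𝓝 0) := by
    simpa using ((tendsto_const_nhds (x := L₀).sub hlimL).norm.mul_const R).add
      (tendsto_const_nhds (x := v₀).sub hlimv).norm
  filter_upwards [hsmall.eventually_lt_const hε] with n hn x hx
  refine lt_of_le_of_lt ?_ hn
  have : g x - f (σ n) x = (L₀ - L (σ n)) x + (v₀ - v (σ n)) := by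
    simp [g, hL]; abel
  rw [dist_eq_norm, this]
  refine (norm_add_le _ _).trans ?_
  gcongr
  exact ((L₀ - L (σ n)).le_opNorm x).trans (by gcongr; exact hR x hx)

/-- Eventually `f n '' K` has nearly the measure of `g '' K` and lies in a thin neighbourhood of it
whose trace on K is hardly larger in measure, so little of `g '' K` is left over. -/
theorem eventually_measure_diff_lt (h : IsSeparatedIFS K φ a) {s : ℝ} (hs : 0 < s)
    (hsum : ∑ i, a i ^ s = 1)
    {f : ℕ → EuclideanSpace ℝ (Fin d) → EuclideanSpace ℝ (Fin d)} {ρ : ℕ → ℝ}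
    {g : EuclideanSpace ℝ (Fin d) → EuclideanSpace ℝ (Fin d)} {ρ₀ : ℝ}
    (hf : ∀ n, IsSimilitudeWithRatio (f n) (ρ n)) (hfK : ∀ n, MapsTo (f n) K K)
    (hg : IsSimilitudeWithRatio g ρ₀) (hgK : MapsTo g K K) (hρ : Tendsto ρ atTop (𝓝 ρ₀))
    (hlim : TendstoUniformlyOn f g atTop K) {ε : ℝ} (hε : 0 < ε) :
    ∀ᶠ n in atTop, μH[s] (g '' K \ f n '' K) ≤ ENNReal.ofReal ε := by
  have hK := h.selfSimilar.isCompact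
  -- Restriction to K makes the measure finite, so that thickenings of a compact set converge to it
  -- in measure.
  set ν := (μH[s] : Measure (EuclideanSpace ℝ (Fin d))).restrict K
  have : IsFiniteMeasure ν := ⟨by
    rw [Measure.restrict_apply_univ]; exact (h.measure_ne_top hs hsum).lt_top⟩
  have hν : ∀ {A}, A ⊆ K → ν A = μH[s] A := fun hA => by
    rw [Measure.restrict_apply' hK.measurableSet, inter_eq_left.2 hA]
  have hfn : ∀ n, IsCompact (f n '' K) := fun n => hK.image (hf n).continuous
  have hgc : IsCompact (g '' K) := hK.image hg.continuous
  have himage : ∀ {k : EuclideanSpace ℝ (Fin d) → EuclideanSpace ℝ (Fin d)} {τ : ℝ},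
      IsSimilitudeWithRatio k τ → MapsTo k K K → ν.real (k '' K) = τ ^ s * ν.real K :=
    fun hk hkK => by
      rw [measureReal_def, hν hkK.image_subset, hk.hausdorffMeasure_image hs.le,
        ENNReal.toReal_mul, ENNReal.toReal_ofReal (Real.rpow_nonneg hk.1.le _), measureReal_def,
        hν subset_rfl]
  have h1 : Tendsto (fun n => ν.real (f n '' K)) atTop (𝓝 (ν.real (g '' K))) := by
    rw [himage hg hgK]
    simp only [himage (hf _) (hfK _)]
    exact (hρ.rpow_const (Or.inl hg.1.ne')).mul_const _
  have h2 : Tendsto (fun δ => ν.real (cthickening δ (g '' K))) (𝓝 0) (𝓝 (ν.real (g '' K))) :=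
    (ENNReal.tendsto_toReal (MeasureTheory.measure_ne_top _ _)).comp (tendsto_measure_cthickening_of_isCompact hgc)
  obtain ⟨δ, hδε, hδ⟩ := (((h2.eventually_lt_const (lt_add_of_pos_right _ (half_pos hε))).filter_mono
    nhdsWithin_le_nhds).and self_mem_nhdsWithin : ∀ᶠ δ in 𝓝[>] (0 : ℝ), _).exists
  filter_upwards [h1.eventually_const_lt (sub_lt_self _ (half_pos hε)),
    Metric.tendstoUniformlyOn_iff.1 hlim δ hδ] with n hn hnδ
  have hsub : f n '' K ∪ g '' K \ f n '' K ⊆ cthickening δ (g '' K) := by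
    rintro _ (⟨x, hx, rfl⟩ | hy)
    · refine mem_cthickening_of_dist_le _ (g x) _ _ ⟨x, hx, rfl⟩ ?_
      rw [dist_comm]
      exact (hnδ x hx).le
    · exact self_subset_cthickening _ hy.1
  have h3 := measureReal_mono (μ := ν) hsub
  rw [measureReal_union disjoint_sdiff_right
    (hgc.measurableSet.diff (hfn n).measurableSet)] at h3
  rw [← hν (sdiff_subset.trans hgK.image_subset), ← ENNReal.ofReal_toReal (MeasureTheory.measure_ne_top ν _)]
  refine ENNReal.ofReal_le_ofReal ?_
  change ν.real _ ≤ _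
  linarith

/-- Rigidity applies to g⁻¹ ∘ f n: the part of K that it misses is the g⁻¹-image of `g '' K \ f n ''
K`. -/
theorem eventually_eqOn (h : IsSeparatedIFS K φ a)
    {f : ℕ → EuclideanSpace ℝ (Fin d) → EuclideanSpace ℝ (Fin d)} {ρ : ℕ → ℝ}
    {g : EuclideanSpace ℝ (Fin d) → EuclideanSpace ℝ (Fin d)} {ρ₀ : ℝ}
    (hf : ∀ n, IsSimilitudeWithRatio (f n) (ρ n)) (hfK : ∀ n, MapsTo (f n) K K)
    (hg : IsSimilitudeWithRatio g ρ₀) (hgK : MapsTo g K K) (hρ : Tendsto ρ atTop (𝓝 ρ₀))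
    (hlim : TendstoUniformlyOn f g atTop K) : ∀ᶠ n in atTop, EqOn (f n) g K := by
  obtain ⟨s, hs, hsum⟩ := h.exists_exponent
  obtain ⟨ε, hε, hrigid⟩ := h.exists_rigidity hs hsum
  obtain ⟨ψ, hψ, hψl, hψr⟩ := hg.exists_inverse
  have hρ₀ := hg.1
  have hμ0 : 0 < (μH[s] K).toReal :=
    ENNReal.toReal_pos (h.measure_ne_zero hs hsum) (h.measure_ne_top hs hsum)
  filter_upwards [Metric.tendstoUniformlyOn_iff.1 hlim (ε * ρ₀) (by positivity),
    h.eventually_measure_diff_lt hs hsum hf hfK hg hgK hρ hlim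
      (ε := ρ₀ ^ s * (ε * (μH[s] K).toReal)) (by positivity)] with n hn hnμ
  have key := hrigid (ψ ∘ f n) _ (hψ.comp (hf n)) (fun x hx => ?_) ?_
  · intro x hx
    rw [← hψr (f n x)]
    exact congrArg g (key hx)
  · have h1 := hn x hx
    rw [Function.comp_apply, ← hψl x, hψl x, ← hψl x, hψ.2, hψl x, dist_comm, inv_mul_le_iff₀ hρ₀]
    linarith
  · have h1 : K \ ψ ∘ f n '' K = ψ '' (g '' K \ f n '' K) := by
      rw [image_sdiff hψ.injective, hψl.image_image, image_comp]
    rw [h1, hψ.hausdorffMeasure_image hs.le]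
    refine (mul_le_mul_right hnμ _).trans_eq ?_
    rw [← ENNReal.ofReal_mul (by positivity), Real.inv_rpow hρ₀.le,
      inv_mul_cancel_left₀ (by positivity), ENNReal.ofReal_mul hε.le,
      ENNReal.ofReal_toReal (h.measure_ne_top hs hsum)]

/-- Up to equality on `K`, only finitely many similitudes with ratio at least `c` map `K` into
itself. -/
theorem exists_lt_eqOn (h : IsSeparatedIFS K φ a) {c : ℝ} (hc : 0 < c)
    {f : ℕ → EuclideanSpace ℝ (Fin d) → EuclideanSpace ℝ (Fin d)} {ρ : ℕ → ℝ}
    (hf : ∀ n, IsSimilitudeWithRatio (f n) (ρ n)) (hcρ : ∀ n, c ≤ ρ n)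
    (hfK : ∀ n, MapsTo (f n) K K) : ∃ n m, n < m ∧ EqOn (f n) (f m) K := by
  obtain ⟨σ, g, ρ₀, hσ, hg, hgK, hρ, hlim⟩ := h.exists_subseq_tendsto hc hf hcρ hfK
  obtain ⟨N, hN⟩ := eventually_atTop.1 (h.eventually_eqOn (fun n => hf (σ n))
    (fun n => hfK (σ n)) hg hgK hρ hlim)
  exact ⟨σ N, σ (N + 1), hσ N.lt_succ_self, (hN N le_rfl).trans (hN (N + 1) (by omega)).symm⟩

end IsSeparatedIFS

/-! ### Factorization through cylinders and the conclusion -/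

theorem IsSimilitudeWithRatio.exists_affineMap {d : ℕ}
    {f : EuclideanSpace ℝ (Fin d) → EuclideanSpace ℝ (Fin d)} {ρ : ℝ}
    (hf : IsSimilitudeWithRatio f ρ) :
    ∃ F : EuclideanSpace ℝ (Fin d) →ᵃ[ℝ] EuclideanSpace ℝ (Fin d), ⇑F = f := by
  obtain ⟨L, v, hL⟩ := hf.exists_affine
  exact ⟨(L : _ →ₗ[ℝ] _).toAffineMap + AffineMap.const ℝ _ v, funext fun x => (hL x).symm⟩

/-- An injective affine map sending `K` into itself preserves the affine span of `K`. -/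
theorem affineSpan_image_eq_of_mapsTo {E : Type*} [AddCommGroup E] [Module ℝ E]
    [FiniteDimensional ℝ E] {K : Set E} (hne : K.Nonempty) {F : E →ᵃ[ℝ] E}
    (hF : Function.Injective F) (hFK : MapsTo F K K) : affineSpan ℝ (F '' K) = affineSpan ℝ K := by
  have hle : affineSpan ℝ (F '' K) ≤ affineSpan ℝ K := affineSpan_mono ℝ hFK.image_subset
  refine AffineSubspace.eq_of_direction_eq_of_nonempty_of_le ?_
    ((affineSpan_nonempty ℝ).2 (hne.image F)) hle
  refine Submodule.eq_of_le_of_finrank_eq (AffineSubspace.direction_le hle) ?_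
  rw [← AffineSubspace.map_span, AffineSubspace.map_direction]
  exact (Submodule.equivMapOfInjective F.linear (F.linear_injective_iff.2 hF) _).finrank_eq.symm

namespace IsSeparatedIFS

variable {d r : ℕ} {K : Set (EuclideanSpace ℝ (Fin d))}
  {φ : Fin r → EuclideanSpace ℝ (Fin d) → EuclideanSpace ℝ (Fin d)} {a : Fin r → ℝ}

/-- Every similitude mapping `K` into itself factors through a cylinder map, with a remaining
similitude of ratio bounded below. -/
theorem exists_factorization (h : IsSeparatedIFS K φ a) :
    ∃ c > 0, ∀ (f : EuclideanSpace ℝ (Fin d) → EuclideanSpace ℝ (Fin d)) (ρ : ℝ),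
      IsSimilitudeWithRatio f ρ → MapsTo f K K →
      ∃ (I : List (Fin r)) (g : EuclideanSpace ℝ (Fin d) → EuclideanSpace ℝ (Fin d)) (τ : ℝ),
        IsSimilitudeWithRatio g τ ∧ MapsTo g K K ∧ c ≤ τ ∧ multiComp φ I ∘ g = f := by
  obtain ⟨-, q, -, -, hq0, hq1, -, haq⟩ := h.exists_bounds
  obtain ⟨η, hη, hsep⟩ := h.exists_separation
  obtain ⟨D, hD, hdist⟩ := h.exists_dist_le
  -- If f(K) has two points at distance at least η times the ratio w of `I`, then ρD ≥ ηw. Otherwise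
  -- the descent reached length `N`, and w ≤ q^N < ρ.
  refine ⟨min 1 (η / D), by positivity, fun f ρ hf hfK => ?_⟩
  obtain ⟨N, hN⟩ := exists_pow_lt_of_lt_one hf.1 hq1
  obtain ⟨I, hI, hor⟩ := h.exists_cylinder_superset hsep hfK.image_subset
    (h.selfSimilar.nonempty.image f) N
  obtain ⟨ψ, hψ, hψl, hψr⟩ := (h.similitude I).exists_inverse
  have hw := wordRatio_pos h.pos I
  refine ⟨I, ψ ∘ f, _, hψ.comp hf, fun x hx => ?_, ?_, funext fun x => hψr (f x)⟩
  · obtain ⟨y, hy, hyx⟩ := hI ⟨x, hx, rfl⟩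
    rw [Function.comp_apply, ← hyx, hψl]
    exact hy
  · rw [inv_mul_eq_div, le_div_iff₀ hw]
    rcases hor with ⟨_, ⟨x, hx, rfl⟩, _, ⟨y, hy, rfl⟩, hxy⟩ | hlen
    · rw [hf.2] at hxy
      refine (mul_le_mul_of_nonneg_right (min_le_right _ _) hw.le).trans ?_
      rw [div_mul_eq_mul_div, div_le_iff₀ hD]
      exact hxy.trans (mul_le_mul_of_nonneg_left (hdist x hx y hy) hf.1.le)
    · refine (mul_le_mul_of_nonneg_right (min_le_left _ _) hw.le).trans ?_
      have := wordRatio_le_pow_length h.pos haq I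
      rw [hlen] at this
      linarith

theorem exists_iterate_comp_eqOn (h : IsSeparatedIFS K φ a)
    {lam : EuclideanSpace ℝ (Fin d) → EuclideanSpace ℝ (Fin d)} {b : ℝ}
    (hlam : IsSimilitudeWithRatio lam b) (hlamK : MapsTo lam K K) :
    ∃ k : ℕ, 1 ≤ k ∧ ∃ I J : List (Fin r),
      EqOn (lam^[k] ∘ multiComp φ I) (multiComp φ J)
        (affineSpan ℝ K : Set (EuclideanSpace ℝ (Fin d))) := by
  obtain ⟨c, hc, hfac⟩ := h.exists_factorization
  choose I f τ hf hfK hcτ hIf using fun n : ℕ => hfac lam^[n] _ (hlam.iterate n) (hlamK.iterate n)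
  obtain ⟨n, m, hnm, heq⟩ := h.exists_lt_eqOn hc hf hcτ hfK
  refine ⟨m - n, by omega, I n, I m, ?_⟩
  obtain ⟨F, hF⟩ := ((hlam.iterate (m - n)).comp (h.similitude (I n))).exists_affineMap
  obtain ⟨G, hG⟩ := (h.similitude (I m)).exists_affineMap
  obtain ⟨T, hT⟩ := (hf n).exists_affineMap
  have hspan : affineSpan ℝ (T '' K) = affineSpan ℝ K :=
    affineSpan_image_eq_of_mapsTo h.selfSimilar.nonempty (hT ▸ (hf n).injective) (hT ▸ hfK n)
  -- On K, λ^(m-n) ∘ φ_{Iₙ} ∘ fₙ = λ^m = φ_{Iₘ} ∘ fₘ, and fₘ = fₙ.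
  have hFG : EqOn F G (T '' K) := by
    rintro _ ⟨x, hx, rfl⟩
    rw [hF, hG, hT]
    have h1 := congrFun (hIf n) x
    have h2 := congrFun (hIf m) x
    simp only [Function.comp_apply] at h1 h2 ⊢
    rw [h1, heq hx, h2, ← Function.iterate_add_apply, Nat.sub_add_cancel hnm.le]
  rw [← hspan, ← hF, ← hG]
  -- The points where F and G agree form an affine subspace, the preimage of {0} under F - G.
  have hle : affineSpan ℝ (T '' K) ≤ (AffineSubspace.mk' (0 : EuclideanSpace ℝ (Fin d)) ⊥).comap
      (F - G) := affineSpan_le.2 fun x hx => by simp [hFG hx]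
  intro x hx
  have := hle hx
  simpa [sub_eq_zero] using this

/-- K has two distinct points, so both sides have the same ratio; its logarithm counts the letters
of `I` and `J`. -/
theorem exists_rat_log (h : IsSeparatedIFS K φ a)
    {lam : EuclideanSpace ℝ (Fin d) → EuclideanSpace ℝ (Fin d)} {b : ℝ}
    (hlam : IsSimilitudeWithRatio lam b) {k : ℕ} (hk : 1 ≤ k) {I J : List (Fin r)}
    (heq : EqOn (lam^[k] ∘ multiComp φ I) (multiComp φ J) K) :
    ∃ q : Fin r → ℚ, Real.log b = ∑ i, (q i : ℝ) * Real.log (a i) := by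
  obtain ⟨x, hx, y, hy, hxy⟩ := h.exists_ne
  have h1 : b ^ k * wordRatio a I = wordRatio a J := by
    refine mul_right_cancel₀ (dist_pos.2 hxy).ne' ?_
    rw [← ((hlam.iterate k).comp (h.similitude I)).2, ← (h.similitude J).2, heq hx, heq hy]
  have h2 := congrArg Real.log h1
  have hb := hlam.1
  rw [Real.log_mul (by positivity) (wordRatio_pos h.pos I).ne', Real.log_pow,
    log_wordRatio h.pos, log_wordRatio h.pos] at h2
  have hk0 : (k : ℝ) ≠ 0 := by positivity
  refine ⟨fun i => ((J.count i : ℚ) - I.count i) / k, ?_⟩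
  refine mul_left_cancel₀ hk0 ?_
  rw [eq_sub_of_add_eq h2, ← Finset.sum_sub_distrib, Finset.mul_sum]
  refine Finset.sum_congr rfl fun i _ => ?_
  push_cast
  field_simp

end IsSeparatedIFS

theorem theorem4p10 {d r : ℕ} (K : Set (EuclideanSpace ℝ (Fin d)))
    (φ : Fin r → EuclideanSpace ℝ (Fin d) → EuclideanSpace ℝ (Fin d))
    (hK : IsSelfSimilar K φ) (hsep : StrongSeparation K φ)
    (lam : EuclideanSpace ℝ (Fin d) → EuclideanSpace ℝ (Fin d))
    (hlam : IsSimilitude lam) (hlamK : lam '' K ⊆ K) :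
    (∃ k : ℕ, 1 ≤ k ∧ ∃ I J : List (Fin r),
      Set.EqOn (lam^[k] ∘ multiComp φ I) (multiComp φ J)
        (affineSpan ℝ K : Set (EuclideanSpace ℝ (Fin d)))) ∧
    (∀ (a : Fin r → ℝ) (b : ℝ),
      (∀ i, IsSimilitudeWithRatio (φ i) (a i)) → IsSimilitudeWithRatio lam b →
      ∃ q : Fin r → ℚ, Real.log b = ∑ i, (q i : ℝ) * Real.log (a i)) := by
  obtain ⟨b₀, hb₀⟩ := hlam
  choose a₀ ha₀ using hK.isSimilitude
  obtain ⟨k, hk, I, J, heq⟩ := (IsSeparatedIFS.mk hK hsep ha₀).exists_iterate_comp_eqOn hb₀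
    (mapsTo_iff_image_subset.2 hlamK)
  exact ⟨⟨k, hk, I, J, heq⟩, fun a b ha hb => (IsSeparatedIFS.mk hK hsep ha).exists_rat_log hb hk
    (heq.mono (subset_affineSpan ℝ K))⟩
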